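/- Let $a_1,\dots,a_m\in\mathbb Z^n$ be linearly independent over $\mathbb R$, and let $a_0\in\mathbb Z^n$ lie in the (relative) interior of the convex hull of $\{a_1,\dots,a_m\}$; equivalently, there are positive integers $\ell_0,\ell_1,\dots,\ell_m$ with greatest common divisor $1$ such that $$\ell_0a_0=\sum_{j=1}^m\ell_ja_j,\qquad \ell_0=\sum_{j=1}^m\ell_j .$$ With $\lambda$ an indeterminate and $x^u=x_1^{u_1}\cdots x_n^{u_n}$, put $$f_\lambda=\sum_{j=1}^m\ell_jx^{a_j}-\ell_0\lambda x^{a_0}\in\mathbb C(\lambda)[x_1^{\pm1},\dots,x_n^{\pm1}].$$ Let $V\subseteq\mathbb R^n$ be the real span of $a_1,\dots,a_m$, let $V_{\mathbb Z}=V\cap\mathbb Z^n$, let $\mathbb ZA\subseteq V_{\mathbb Z}$ be the subgroup generated by $a_1,\dots,a_m$, and put $$M=V_{\mathbb Z}\cap\Big\{\sum_{j=1}^mc_ja_j : c_j\in\mathbb R,\ c_j\ge0\Big\},\qquad \mathcal B=V_{\mathbb Z}\cap\Big\{\sum_{j=1}^mc_ja_j : c_j\in\mathbb R,\ 0\le c_j<1\Big\}\subseteq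 M .$$ Let $S'$ be the $\mathbb C(\lambda)$-subalgebra of $\mathbb C(\lambda)[x_1^{\pm1},\dots,x_n^{\pm1}]$ generated by $\{x^u : u\in M\}$. The operators $$D_i=x_i\frac{\partial}{\partial x_i}+x_i\frac{\partial f_\lambda}{\partial x_i}\qquad(i=1,\dots,n)$$ (the second term acting by multiplication) map $S'$ into itself; let $\mathcal W'=S'\big/\sum_{i=1}^nD_iS'$, a $\mathbb C(\lambda)$-vector space. Then the classes of the monomials $x^b$, $b\in\mathcal B$, form a $\mathbb C(\lambda)$-basis of $\mathcal W'$ (in particular, distinct $b$ give distinct classes). Hence $\mathcal B$ is finite and $\mathcal W'$ has dimension $d$ over $\mathbb C(\lambda)$, where $d=|\mathcal B|=[V_{\mathbb Z}:\mathbb ZA]$. -/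

import Mathlib

noncomputable section

open scoped BigOperators

/-- The inclusion of the lattice of exponent vectors `ℤⁿ` in `ℝⁿ`. -/
def toReal {n : ℕ} : (Fin n → ℤ) →+ (Fin n → ℝ) where
  toFun u i := (u i : ℝ)
  map_zero' := by ext; simp
  map_add' u v := by ext; simp

/-- The Laurent polynomial ring `K[x₁^{±1}, …, xₙ^{±1}]`: the monoid algebra of `ℤⁿ`. The monomial
`x^u` is `AddMonoidAlgebra.single u 1`. -/
abbrev Laurent (K : Type*) [Field K] (n : ℕ) : Type _ := AddMonoidAlgebra K (Fin n → ℤ)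

/-- The monomial `x^u`. -/
abbrev xpow (K : Type*) [Field K] {n : ℕ} (u : Fin n → ℤ) : Laurent K n :=
  AddMonoidAlgebra.single u 1

/-- The `K`-linear operator `∑_u c_u x^u ↦ ∑_u c_u u_i x^u`. -/
def eulerLinear (K : Type*) [Field K] {n : ℕ} (i : Fin n) : Laurent K n →ₗ[K] Laurent K n :=
  Finsupp.linearCombination K
      (fun u : Fin n → ℤ => (AddMonoidAlgebra.single u (u i : K) : Laurent K n)) ∘ₗ
    (AddMonoidAlgebra.coeffLinearEquiv K).toLinearMap

theorem eulerLinear_single (K : Type*) [Field K] {n : ℕ} (i : Fin n) (u : Fin n → ℤ) (c : K) :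
    eulerLinear K i (AddMonoidAlgebra.single u c) = AddMonoidAlgebra.single u ((u i : K) * c) := by
  simp [eulerLinear, mul_comm]

theorem eulerLinear_mul (K : Type*) [Field K] {n : ℕ} (i : Fin n) (f g : Laurent K n) :
    eulerLinear K i (f * g) = f • eulerLinear K i g + g • eulerLinear K i f := by
  induction f using AddMonoidAlgebra.induction_linear with
  | zero => simp
  | add f₁ f₂ h₁ h₂ => simp only [add_mul, map_add, h₁, h₂, smul_eq_mul, mul_add]; abel
  | single u c =>
    induction g using AddMonoidAlgebra.induction_linear with
    | zero => simp
    | add g₁ g₂ h₁ h₂ =>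
      simp only [add_mul, mul_add, map_add, h₁, h₂, smul_eq_mul]; abel
    | single v d =>
      simp only [AddMonoidAlgebra.single_mul_single, eulerLinear_single, smul_eq_mul]
      rw [add_comm v u, ← AddMonoidAlgebra.single_add]
      congr 1
      push_cast [Pi.add_apply]
      ring

/-- The derivation `x_i ∂/∂x_i` of the Laurent polynomial ring, `x^u ↦ u_i x^u`. -/
def euler (K : Type*) [Field K] {n : ℕ} (i : Fin n) :
    Derivation K (Laurent K n) (Laurent K n) :=
  Derivation.mk' (eulerLinear K i) (eulerLinear_mul K i)

theorem euler_single (K : Type*) [Field K] {n : ℕ} (i : Fin n) (u : Fin n → ℤ) (c : K) :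
    euler K i (AddMonoidAlgebra.single u c) = AddMonoidAlgebra.single u ((u i : K) * c) :=
  eulerLinear_single K i u c

/-- The exponents and coefficients of a monomial deformation
`f_λ = ∑ⱼ ℓⱼ x^{aⱼ} - ℓ₀ λ x^{a₀}` of a generalized Delsarte polynomial: the vectors
`a₁, …, a_m ∈ ℤⁿ` are linearly independent over `ℝ`, and `a₀ ∈ ℤⁿ` satisfies
`ℓ₀ a₀ = ∑ⱼ ℓⱼ aⱼ` with positive integers `ℓ₀, ℓ₁, …, ℓ_m` of greatest common divisor `1` and
`ℓ₀ = ∑ⱼ ℓⱼ`. -/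
structure DelsarteDeformation (n m : ℕ) where
  a : Fin m → Fin n → ℤ
  a₀ : Fin n → ℤ
  l : Fin m → ℕ
  l₀ : ℕ
  linearIndependent : LinearIndependent ℝ (fun j => toReal (a j))
  l_pos : ∀ j, 0 < l j
  l₀_pos : 0 < l₀
  gcd_eq_one : Nat.gcd l₀ (Finset.univ.gcd l) = 1
  relation : (l₀ : ℤ) • a₀ = ∑ j, (l j : ℤ) • a j
  l₀_eq_sum : l₀ = ∑ j, l j

namespace DelsarteDeformation

variable {n m : ℕ} (P : DelsarteDeformation n m)

/-- The real subspace `V` of `ℝⁿ` spanned by `a₁, …, a_m`. -/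
def V : Submodule ℝ (Fin n → ℝ) := Submodule.span ℝ (Set.range fun j => toReal (P.a j))

/-- The lattice `V_ℤ = V ∩ ℤⁿ`. -/
def VZ : AddSubgroup (Fin n → ℤ) := P.V.toAddSubgroup.comap toReal

/-- The subgroup `ℤA` of `V_ℤ` generated by `a₁, …, a_m`. -/
def ZA : AddSubgroup (Fin n → ℤ) := AddSubgroup.closure (Set.range P.a)

/-- The real cone `C(A)` generated by `a₁, …, a_m`. -/
def cone : Set (Fin n → ℝ) :=
  {v | ∃ c : Fin m → ℝ, (∀ j, 0 ≤ c j) ∧ v = ∑ j, c j • toReal (P.a j)}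

/-- The half-open parallelepiped `P(A)`. -/
def parallelepiped : Set (Fin n → ℝ) :=
  {v | ∃ c : Fin m → ℝ, (∀ j, 0 ≤ c j ∧ c j < 1) ∧ v = ∑ j, c j • toReal (P.a j)}

/-- The monoid `M = V_ℤ ∩ C(A)`, as a set of exponents. -/
def M : Set (Fin n → ℤ) := {u | u ∈ P.VZ ∧ toReal u ∈ P.cone}

/-- The set `ℬ = V_ℤ ∩ P(A)`. -/
def B : Set (Fin n → ℤ) := {u | u ∈ P.VZ ∧ toReal u ∈ P.parallelepiped}

/-- The field `ℂ(λ)`; the indeterminate `λ` is `RatFunc.X`. -/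
abbrev K : Type := RatFunc ℂ

/-- The Laurent polynomial `f_λ = ∑ⱼ ℓⱼ x^{aⱼ} - ℓ₀ λ x^{a₀}` over `ℂ(λ)`. -/
def f : Laurent K n :=
  ∑ j, (P.l j : K) • xpow K (P.a j) - ((P.l₀ : K) * RatFunc.X) • xpow K P.a₀

/-- The `ℂ(λ)`-algebra `S'` generated by the monomials `x^u`, `u ∈ M`. -/
def S' : Subalgebra K (Laurent K n) := Algebra.adjoin K (xpow K '' P.M)

theorem mem_VZ_of_eq_sum {u : Fin n → ℤ} {c : Fin m → ℝ}
    (h : toReal u = ∑ j, c j • toReal (P.a j)) : u ∈ P.VZ := by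
  change toReal u ∈ P.V
  rw [h]
  exact P.V.sum_mem fun j _ => P.V.smul_mem _ (Submodule.subset_span ⟨j, rfl⟩)

theorem a_mem_M (j : Fin m) : P.a j ∈ P.M := by
  have h : toReal (P.a j) = ∑ k, (if k = j then (1 : ℝ) else 0) • toReal (P.a k) := by simp
  exact ⟨P.mem_VZ_of_eq_sum h, _, fun k => by split_ifs <;> norm_num, h⟩

theorem a₀_mem_M : P.a₀ ∈ P.M := by
  have h0 : (P.l₀ : ℝ) ≠ 0 := by exact_mod_cast P.l₀_pos.ne'
  have h : toReal P.a₀ = ∑ k, ((P.l k : ℝ) / P.l₀) • toReal (P.a k) := by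
    ext i
    have := congrArg (fun z : ℤ => (z : ℝ)) (congrFun P.relation i)
    simp only [Pi.smul_apply, Finset.sum_apply, smul_eq_mul] at this
    push_cast at this
    simp only [toReal, AddMonoidHom.coe_mk, ZeroHom.coe_mk, Finset.sum_apply, Pi.smul_apply,
      smul_eq_mul]
    rw [eq_comm, ← mul_right_inj' h0, this, Finset.mul_sum]
    refine Finset.sum_congr rfl fun j _ => ?_
    field_simp
  exact ⟨P.mem_VZ_of_eq_sum h, _, fun k => by positivity, h⟩

theorem B_subset_M : P.B ⊆ P.M := fun _ hu =>
  ⟨hu.1, hu.2.imp fun _ hc => ⟨fun j => (hc.1 j).1, hc.2⟩⟩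

theorem xpow_mem_S' {u : Fin n → ℤ} (hu : u ∈ P.M) : xpow K u ∈ P.S' :=
  Algebra.subset_adjoin ⟨u, hu, rfl⟩

theorem f_mem_S' : P.f ∈ P.S' :=
  P.S'.sub_mem (P.S'.sum_mem fun j _ => P.S'.smul_mem (P.xpow_mem_S' (P.a_mem_M j)) _)
    (P.S'.smul_mem (P.xpow_mem_S' P.a₀_mem_M) _)

theorem euler_mem_S' (i : Fin n) {g : Laurent K n} (hg : g ∈ P.S') : euler K i g ∈ P.S' := by
  induction hg using Algebra.adjoin_induction with
  | mem g hg =>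
    obtain ⟨u, hu, rfl⟩ := hg
    have h : euler K i (xpow K u) = (u i : K) • xpow K u := by
      rw [euler_single, AddMonoidAlgebra.smul_single]; rfl
    rw [h]
    exact P.S'.smul_mem (P.xpow_mem_S' hu) _
  | algebraMap r => rw [Derivation.map_algebraMap]; exact P.S'.zero_mem
  | add g h _ _ hg hh => rw [map_add]; exact P.S'.add_mem hg hh
  | mul g h hg' hh' hg hh =>
    rw [Derivation.leibniz]
    exact P.S'.add_mem (P.S'.mul_mem hg' hh) (P.S'.mul_mem hh' hg)

/-- The operator `D_i = x_i ∂/∂x_i + x_i ∂f_λ/∂x_i` on `S'`. -/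
def D (i : Fin n) : P.S' →ₗ[K] P.S' :=
  LinearMap.restrict
    ((euler K i : Laurent K n →ₗ[K] Laurent K n) + LinearMap.mulLeft K (euler K i P.f))
    (p := Subalgebra.toSubmodule P.S') (q := Subalgebra.toSubmodule P.S')
    fun _ hg => P.S'.add_mem (P.euler_mem_S' i hg)
      (P.S'.mul_mem (P.euler_mem_S' i P.f_mem_S') hg)

theorem coe_D (i : Fin n) (g : P.S') :
    (P.D i g : Laurent K n) = euler K i (g : Laurent K n) + euler K i P.f * g := rfl

/-- The `ℂ(λ)`-vector space `W' = S' / ∑ᵢ D_i S'`. -/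
abbrev W' : Type := P.S' ⧸ (⨆ i, LinearMap.range (P.D i))

/-- The class in `W'` of the monomial `x^u`, `u ∈ M`. -/
def monomialClass (u : P.M) : P.W' :=
  (⨆ i, LinearMap.range (P.D i)).mkQ ⟨xpow K u.1, P.xpow_mem_S' u.2⟩

end DelsarteDeformation

end

noncomputable section

open scoped BigOperators

/-! ### Coordinates along `a₁, …, a_m` and the lattice index -/

namespace DelsarteDeformation

variable {n m : ℕ} (P : DelsarteDeformation n m)

/-! Write `c_k(u)` for the coordinates of `u` along the independent `a_k`. Inverting the matrix of
the `a_k` replaces the operators `D_i` by one relation per `k`: `c_k(u) x^u + ℓ_k x^(u+a_k) = ℓ_k λ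
x^(u+a₀)` in `W'` (`rel_mem`, `relSubmodule_le`).

Spanning: grade by the weight `∑ c_k`, for which `a₀` and all `a_k` have weight 1. Modulo lower
weight, a monomial outside `ℬ` equals `λ` times another of the same weight. Each weight has finitely
many exponents, so a chain that never enters `ℬ` has a cycle `x^v ≡ λ^t x^v` with `t > 0`; since
`λ^t ≠ 1`, `x^v` reduces to lower weight (`spanB_eq_top`).

Independence: at `λ = 0` the relations are two-term recursions, solved by Gamma-like products `h_b`
supported on the class of `b` modulo `ℤA`. Multiplication by `exp(-ℓ₀ λ x^(a₀))` formally carries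
the relations to those at `λ = 0`; composing it with `h_b` gives functionals to `ℂ((λ))` that kill
every `D_i S'`. Their matrix on `ℬ` is the identity at `λ = 0`, hence invertible
(`linearIndependent_B`). -/

theorem exists_dual : ∃ g : (Fin n → ℝ) →ₗ[ℝ] (Fin m → ℝ),
    g ∘ₗ Fintype.linearCombination ℝ (fun j => toReal (P.a j)) = LinearMap.id :=
  LinearMap.exists_leftInverse_of_injective _
    (LinearMap.ker_eq_bot.2 (linearIndependent_iff_injective_fintypeLinearCombination.1 P.linearIndependent))

/-- A linear map `ℝⁿ → ℝᵐ` that sends `aⱼ` to the `j`-th standard basis vector. -/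
def dual : (Fin n → ℝ) →ₗ[ℝ] (Fin m → ℝ) := P.exists_dual.choose

theorem dual_sum (c : Fin m → ℝ) : P.dual (∑ j, c j • toReal (P.a j)) = c := by
  have := LinearMap.congr_fun P.exists_dual.choose_spec c
  rwa [LinearMap.comp_apply, Fintype.linearCombination_apply] at this

/-- The coordinates of a lattice vector with respect to `a₁, …, a_m`. -/
def coord : (Fin n → ℤ) →+ (Fin m → ℝ) := P.dual.toAddMonoidHom.comp toReal

theorem coord_eq_of_toReal_eq {u : Fin n → ℤ} {c : Fin m → ℝ}
    (h : toReal u = ∑ j, c j • toReal (P.a j)) : P.coord u = c := by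
  change P.dual (toReal u) = c
  rw [h, P.dual_sum]

theorem toReal_eq_sum_coord {u : Fin n → ℤ} (hu : u ∈ P.VZ) :
    toReal u = ∑ j, P.coord u j • toReal (P.a j) := by
  obtain ⟨c, hc⟩ := (Submodule.mem_span_range_iff_exists_fun ℝ).1
    (show toReal u ∈ Submodule.span ℝ (Set.range fun j => toReal (P.a j)) from hu)
  rw [P.coord_eq_of_toReal_eq hc.symm, hc]

theorem cast_eq_sum_coord {u : Fin n → ℤ} (hu : u ∈ P.VZ) (i : Fin n) :
    (u i : ℝ) = ∑ j, P.coord u j * (P.a j i : ℝ) := by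
  simpa [toReal] using congrFun (P.toReal_eq_sum_coord hu) i

theorem coord_injOn {u v : Fin n → ℤ} (hu : u ∈ P.VZ) (hv : v ∈ P.VZ)
    (h : P.coord u = P.coord v) : u = v := by
  ext i
  have := P.cast_eq_sum_coord hu i
  rw [h, ← P.cast_eq_sum_coord hv i] at this
  exact_mod_cast this

theorem coord_a (j : Fin m) : P.coord (P.a j) = Pi.single j 1 :=
  P.coord_eq_of_toReal_eq (by simp [Pi.single_apply])

theorem l₀_mul_a₀ (i : Fin n) : (P.l₀ : ℤ) * P.a₀ i = ∑ j, (P.l j : ℤ) * P.a j i := by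
  simpa using congrFun P.relation i

theorem l₀_ne_zero : (P.l₀ : ℝ) ≠ 0 := by exact_mod_cast P.l₀_pos.ne'

theorem coord_a₀ (k : Fin m) : P.coord P.a₀ k = (P.l k : ℝ) / P.l₀ := by
  refine congrFun (P.coord_eq_of_toReal_eq (c := fun k => (P.l k : ℝ) / P.l₀) ?_) k
  ext i
  have h := congrArg (fun z : ℤ => (z : ℝ)) (P.l₀_mul_a₀ i)
  push_cast at h
  simp only [toReal, AddMonoidHom.coe_mk, ZeroHom.coe_mk, Finset.sum_apply, Pi.smul_apply,
    smul_eq_mul]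
  rw [← mul_right_inj' P.l₀_ne_zero, h, Finset.mul_sum]
  refine Finset.sum_congr rfl fun j _ => ?_
  have := P.l₀_ne_zero
  field_simp

theorem mem_M_iff {u : Fin n → ℤ} : u ∈ P.M ↔ u ∈ P.VZ ∧ ∀ j, 0 ≤ P.coord u j := by
  refine and_congr_right fun hu => ⟨?_, fun h => ⟨_, h, P.toReal_eq_sum_coord hu⟩⟩
  rintro ⟨c, hc, h⟩
  rwa [P.coord_eq_of_toReal_eq h]

theorem mem_B_iff {u : Fin n → ℤ} :
    u ∈ P.B ↔ u ∈ P.VZ ∧ ∀ j, 0 ≤ P.coord u j ∧ P.coord u j < 1 := by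
  refine and_congr_right fun hu => ⟨?_, fun h => ⟨_, h, P.toReal_eq_sum_coord hu⟩⟩
  rintro ⟨c, hc, h⟩
  rwa [P.coord_eq_of_toReal_eq h]

theorem zero_mem_M : (0 : Fin n → ℤ) ∈ P.M :=
  P.mem_M_iff.2 ⟨P.VZ.zero_mem, fun j => by simp⟩

theorem add_mem_M {u v : Fin n → ℤ} (hu : u ∈ P.M) (hv : v ∈ P.M) : u + v ∈ P.M := by
  rw [mem_M_iff] at *
  exact ⟨P.VZ.add_mem hu.1 hv.1, fun j => by
    rw [map_add]; exact add_nonneg (hu.2 j) (hv.2 j)⟩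

theorem finite_coord_le (N : ℝ) : {u | u ∈ P.M ∧ ∀ j, P.coord u j ≤ N}.Finite := by
  set C : Fin n → ℤ := fun i => ⌈∑ j, N * |(P.a j i : ℝ)|⌉
  refine (Set.finite_Icc (-C) C).subset ?_
  rintro u ⟨hu, hN⟩
  rw [mem_M_iff] at hu
  have key : ∀ i, |u i| ≤ C i := by
    intro i
    have : |(u i : ℝ)| ≤ ∑ j, N * |(P.a j i : ℝ)| := by
      rw [P.cast_eq_sum_coord hu.1 i]
      refine (Finset.abs_sum_le_sum_abs _ _).trans (Finset.sum_le_sum fun j _ => ?_)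
      rw [abs_mul, abs_of_nonneg (hu.2 j)]
      exact mul_le_mul_of_nonneg_right (hN j) (abs_nonneg _)
    have h2 := this.trans (Int.le_ceil _)
    rw [← Int.cast_abs] at h2
    exact Int.cast_le.1 h2
  exact ⟨fun i => (abs_le.1 (key i)).1, fun i => (abs_le.1 (key i)).2⟩

theorem finite_B : P.B.Finite :=
  (P.finite_coord_le 1).subset fun _ hu =>
    ⟨P.B_subset_M hu, fun j => ((P.mem_B_iff.1 hu).2 j).2.le⟩

theorem a_mem_VZ (j : Fin m) : P.a j ∈ P.VZ := (P.a_mem_M j).1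

theorem ZA_le_VZ : P.ZA ≤ P.VZ :=
  (AddSubgroup.closure_le _).2 (by rintro _ ⟨j, rfl⟩; exact P.a_mem_VZ j)

theorem exists_int_coord_of_mem_ZA {u : Fin n → ℤ} (hu : u ∈ P.ZA) (j : Fin m) :
    ∃ z : ℤ, P.coord u j = z := by
  have : P.ZA ≤ (Int.castAddHom ℝ).range.comap ((Pi.evalAddMonoidHom _ j).comp P.coord) := by
    refine (AddSubgroup.closure_le _).2 ?_
    rintro _ ⟨k, rfl⟩
    refine ⟨if j = k then 1 else 0, ?_⟩
    simp [coord_a, Pi.single_apply]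
  obtain ⟨z, hz⟩ := this hu
  exact ⟨z, hz.symm⟩

theorem eq_of_fract_eq {b b' : Fin n → ℤ} (hb : b ∈ P.B) (hb' : b' ∈ P.B)
    (h : ∀ j, Int.fract (P.coord b j) = Int.fract (P.coord b' j)) : b = b' := by
  rw [mem_B_iff] at hb hb'
  refine P.coord_injOn hb.1 hb'.1 (funext fun j => ?_)
  rw [← Int.fract_eq_self.2 (hb.2 j), ← Int.fract_eq_self.2 (hb'.2 j), h j]

/-- Subtracting the integral parts of the coordinates of a lattice vector gives an element of
`ℬ`. -/
def reduce (u : Fin n → ℤ) : Fin n → ℤ := u - ∑ j, ⌊P.coord u j⌋ • P.a j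

theorem sum_mem_ZA (z : Fin m → ℤ) : ∑ j, z j • P.a j ∈ P.ZA :=
  P.ZA.sum_mem fun j _ => P.ZA.zsmul_mem (AddSubgroup.subset_closure ⟨j, rfl⟩) _

theorem coord_reduce (u : Fin n → ℤ) (j : Fin m) :
    P.coord (P.reduce u) j = Int.fract (P.coord u j) := by
  have h : P.coord (∑ k, ⌊P.coord u k⌋ • P.a k) j = ⌊P.coord u j⌋ := by
    simp only [map_sum, map_zsmul, coord_a, Finset.sum_apply, Pi.smul_apply, Pi.single_apply]
    simp
  rw [reduce, map_sub, Pi.sub_apply, h, Int.self_sub_floor]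

theorem reduce_mem_B {u : Fin n → ℤ} (hu : u ∈ P.VZ) : P.reduce u ∈ P.B := by
  refine P.mem_B_iff.2 ⟨P.VZ.sub_mem hu (P.ZA_le_VZ (P.sum_mem_ZA _)), fun j => ?_⟩
  rw [coord_reduce]
  exact ⟨Int.fract_nonneg _, Int.fract_lt_one _⟩

/-- A coset of `ℤA` is determined by the fractional parts of its coordinates, and on `ℬ` the
coordinates equal their fractional parts. -/
theorem ncard_B : P.B.ncard = P.ZA.relIndex P.VZ := by
  refine Nat.card_eq_of_bijective
    (fun b : P.B => (QuotientAddGroup.mk ⟨b.1, b.2.1⟩ : P.VZ ⧸ P.ZA.addSubgroupOf P.VZ)) ⟨?_, ?_⟩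
  · rintro ⟨b, hb⟩ ⟨b', hb'⟩ h
    refine Subtype.ext (P.eq_of_fract_eq hb hb' fun j => ?_)
    obtain ⟨z, hz⟩ := P.exists_int_coord_of_mem_ZA (show -b + b' ∈ P.ZA from
      (QuotientAddGroup.eq (s := P.ZA.addSubgroupOf P.VZ) (a := ⟨b, hb.1⟩) (b := ⟨b', hb'.1⟩)).1 h) j
    refine (Int.fract_eq_fract.2 ⟨z, ?_⟩).symm
    rw [← hz]
    simp only [map_add, map_neg, Pi.add_apply, Pi.neg_apply]
    ring
  · intro q
    induction q using QuotientAddGroup.induction_on with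
    | H u =>
      refine ⟨⟨_, P.reduce_mem_B u.2⟩, QuotientAddGroup.eq.2 ?_⟩
      have := P.sum_mem_ZA fun j => ⌊P.coord u j⌋
      simpa [AddSubgroup.mem_addSubgroupOf, reduce] using this

end DelsarteDeformation

/-! ### Generators and relations for `W'` -/

namespace DelsarteDeformation

variable {n m : ℕ} (P : DelsarteDeformation n m)

/-- The monomial `x^u`, `u ∈ M`, as an element of `S'`. -/
def mono (u : P.M) : P.S' := ⟨xpow K u.1, P.xpow_mem_S' u.2⟩

/-- The sum of two elements of the monoid `M`. -/
def addM (u v : P.M) : P.M := ⟨u.1 + v.1, P.add_mem_M u.2 v.2⟩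

/-- The exponent `aⱼ` as an element of `M`. -/
def aM (j : Fin m) : P.M := ⟨P.a j, P.a_mem_M j⟩

/-- The exponent `a₀` as an element of `M`. -/
def a₀M : P.M := ⟨P.a₀, P.a₀_mem_M⟩

theorem xpow_mul_xpow (u v : Fin n → ℤ) : xpow K u * xpow K v = xpow K (u + v) := by
  simp [AddMonoidAlgebra.single_mul_single]

/-- `M` is closed under addition, so its monomials already form a multiplicative monoid. -/
theorem span_mono : Submodule.span K (Set.range P.mono) = ⊤ := by
  have hcl : (Submonoid.closure (xpow K '' P.M) : Set (Laurent K n)) = xpow K '' P.M := by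
    let T : Submonoid (Laurent K n) :=
      { carrier := xpow K '' P.M
        one_mem' := ⟨0, P.zero_mem_M, rfl⟩
        mul_mem' := by
          rintro _ _ ⟨u, hu, rfl⟩ ⟨v, hv, rfl⟩
          exact ⟨u + v, P.add_mem_M hu hv, (xpow_mul_xpow u v).symm⟩ }
    exact congrArg SetLike.coe (Submonoid.closure_eq T)
  refine (Submodule.map_injective_of_injective
    (f := P.S'.val.toLinearMap) Subtype.val_injective) ?_
  rw [Submodule.map_span, Submodule.map_top]
  have h1 : (P.S'.val.toLinearMap '' Set.range P.mono) = xpow K '' P.M := by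
    rw [← Set.range_comp, Set.image_eq_range]
    rfl
  have h2 : LinearMap.range P.S'.val.toLinearMap = Subalgebra.toSubmodule P.S' :=
    Submodule.range_subtype (Subalgebra.toSubmodule P.S')
  rw [h1, h2, S', Algebra.adjoin_eq_span, hcl]

/-- The relation `c_k(u) x^u + ℓ_k x^(u + a_k) - ℓ_k λ x^(u + a₀)`, where `c_k` is the `k`-th
coordinate. -/
def rel (u : P.M) (k : Fin m) : P.S' :=
  algebraMap ℝ K (P.coord u.1 k) • P.mono u + (P.l k : K) • P.mono (P.addM u (P.aM k)) -
    ((P.l k : K) * RatFunc.X) • P.mono (P.addM u P.a₀M)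

theorem euler_f (i : Fin n) : euler K i P.f =
    ∑ j, ((P.a j i : K) * P.l j) • xpow K (P.a j) -
      ((P.a₀ i : K) * ((P.l₀ : K) * RatFunc.X)) • xpow K P.a₀ := by
  have h : ∀ u : Fin n → ℤ, euler K i (xpow K u) = (u i : K) • xpow K u := fun u => by
    rw [euler_single, AddMonoidAlgebra.smul_single]; rfl
  simp only [f, map_sub, map_sum, Derivation.map_smul, h, smul_smul, mul_comm]

/-- Both `u` and `ℓ₀ a₀` are expanded along the `a_k`, with coefficients `c_k(u)` and `ℓ_k`. -/
theorem D_mono (i : Fin n) (u : P.M) :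
    P.D i (P.mono u) = ∑ k, (P.a k i : K) • P.rel u k := by
  have h1 : (u.1 i : K) = ∑ k, (P.a k i : K) * algebraMap ℝ K (P.coord u.1 k) := by
    have := congrArg (algebraMap ℝ K) (P.cast_eq_sum_coord u.2.1 i)
    simpa [mul_comm] using this
  have h2 : (P.a₀ i : K) * ((P.l₀ : K) * RatFunc.X) =
      ∑ k, (P.a k i : K) * ((P.l k : K) * RatFunc.X) := by
    have := congrArg (fun z : ℤ => (z : K) * RatFunc.X) (P.l₀_mul_a₀ i)
    push_cast at this
    rw [mul_left_comm, ← mul_assoc, this]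
    simp only [Finset.sum_mul]
    exact Finset.sum_congr rfl fun k _ => by ring
  have h3 : euler K i (xpow K u.1) = (u.1 i : K) • xpow K u.1 := by
    rw [euler_single, AddMonoidAlgebra.smul_single]; rfl
  refine Subtype.ext ?_
  rw [coe_D, euler_f, h2]
  simp only [rel, mono, addM, aM, a₀M, AddSubmonoidClass.coe_finsetSum, Subalgebra.coe_smul,
    Subalgebra.coe_sub, Subalgebra.coe_add, h3]
  simp only [smul_sub, smul_add, Finset.sum_add_distrib, Finset.sum_sub_distrib, smul_smul,
    sub_mul, Finset.sum_mul, smul_mul_assoc, xpow_mul_xpow]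
  rw [h1, ← Finset.sum_smul, ← Finset.sum_smul]
  simp only [add_comm u.1]
  abel

/-- The image of the operators `D_i`. -/
abbrev relSubmodule : Submodule K P.S' := ⨆ i, LinearMap.range (P.D i)

/-- The map `dual` gives a left inverse of the matrix of the `a_k`, which solves the system `D_mono`
for the individual relations. -/
theorem rel_mem (u : P.M) (k : Fin m) : P.rel u k ∈ P.relSubmodule := by
  have h : P.rel u k =
      ∑ i, algebraMap ℝ K (P.dual (Pi.single i 1) k) • P.D i (P.mono u) := by
    simp only [D_mono, Finset.smul_sum, smul_smul]
    rw [Finset.sum_comm]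
    simp only [← Finset.sum_smul]
    have : ∀ j, ∑ i, algebraMap ℝ K (P.dual (Pi.single i 1) k) * (P.a j i : K) =
        if k = j then 1 else 0 := by
      intro j
      have h := congrFun (P.coord_a j) k
      have h' : P.coord (P.a j) = ∑ i, (P.a j i : ℝ) • P.dual (Pi.single i 1) := by
        change P.dual (toReal (P.a j)) = _
        conv_lhs => rw [pi_eq_sum_univ' (toReal (P.a j))]
        simp only [map_sum, map_smul, toReal]
        rfl
      rw [h'] at h
      have := congrArg (algebraMap ℝ K) h
      simp only [Finset.sum_apply, Pi.smul_apply, smul_eq_mul, map_sum, map_mul, map_intCast,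
        Pi.single_apply] at this
      simp only [mul_comm (algebraMap ℝ K _), this]
      split_ifs <;> simp
    simp [this]
  rw [h]
  exact Submodule.sum_mem _ fun i _ => Submodule.smul_mem _ _
    (Submodule.mem_iSup_of_mem i ⟨_, rfl⟩)

theorem relSubmodule_le {N : Submodule K P.S'} (h : ∀ u k, P.rel u k ∈ N) :
    P.relSubmodule ≤ N := by
  refine iSup_le fun i => ?_
  rw [LinearMap.range_eq_map, ← P.span_mono, Submodule.map_span, Submodule.span_le]
  rintro _ ⟨_, ⟨u, rfl⟩, rfl⟩
  rw [D_mono]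
  exact N.sum_mem fun k _ => N.smul_mem _ (h u k)

theorem span_monomialClass : Submodule.span K (Set.range P.monomialClass) = ⊤ := by
  have h : Set.range P.monomialClass = P.relSubmodule.mkQ '' Set.range P.mono := by
    rw [← Set.range_comp]; rfl
  rw [h, ← Submodule.map_span, span_mono, Submodule.map_top, Submodule.range_mkQ]

theorem monomialClass_relation (u : P.M) (k : Fin m) :
    algebraMap ℝ K (P.coord u.1 k) • P.monomialClass u +
      (P.l k : K) • P.monomialClass (P.addM u (P.aM k)) -
      ((P.l k : K) * RatFunc.X) • P.monomialClass (P.addM u P.a₀M) = 0 := by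
  have := (Submodule.Quotient.mk_eq_zero P.relSubmodule).2 (P.rel_mem u k)
  rwa [← Submodule.mkQ_apply, rel, map_sub, map_add, map_smul, map_smul, map_smul] at this

/-! ### Spanning: induction on the weight -/

theorem X_pow_ne_one {r : ℕ} (hr : r ≠ 0) : (RatFunc.X : K) ^ r ≠ 1 := by
  intro h
  rw [← RatFunc.algebraMap_X, ← map_pow, ← map_one (algebraMap (Polynomial ℂ) K)] at h
  have := congrArg Polynomial.natDegree (RatFunc.algebraMap_injective ℂ h)
  simp [hr] at this

/-- The span in `W'` of the classes of the monomials with exponent in `ℬ`. -/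
def spanB : Submodule K P.W' :=
  Submodule.span K (Set.range fun b : P.B => P.monomialClass ⟨b.1, P.B_subset_M b.2⟩)

/-- The weight of an exponent: the sum of its coordinates. -/
def weight (u : Fin n → ℤ) : ℝ := ∑ j, P.coord u j

theorem weight_add (u v : Fin n → ℤ) : P.weight (u + v) = P.weight u + P.weight v := by
  simp [weight, Finset.sum_add_distrib]

theorem weight_a (j : Fin m) : P.weight (P.a j) = 1 := by
  simp [weight, coord_a]

/-- The condition `ℓ₀ = ∑ ℓⱼ` enters here: exchanging `a_k` for `a₀` preserves the weight. -/
theorem weight_a₀ : P.weight P.a₀ = 1 := by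
  simp only [weight, coord_a₀, ← Finset.sum_div]
  rw [← Nat.cast_sum, ← P.l₀_eq_sum, div_self P.l₀_ne_zero]

theorem weight_nonneg (u : P.M) : 0 ≤ P.weight u.1 :=
  Finset.sum_nonneg fun j _ => (P.mem_M_iff.1 u.2).2 j

theorem finite_weight_eq (d : ℝ) : {u : P.M | P.weight u.1 = d}.Finite := by
  refine Set.Finite.of_finite_image (f := Subtype.val)
    ((P.finite_coord_le d).subset ?_) Subtype.val_injective.injOn
  rintro _ ⟨u, rfl, rfl⟩
  exact ⟨u.2, fun j => Finset.single_le_sum (fun j _ => (P.mem_M_iff.1 u.2).2 j)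
    (Finset.mem_univ j)⟩

/-- An exponent outside `ℬ` is divisible by some `a_k`; modulo lower weight, its class is `λ`
times the class of another monomial of the same weight. -/
theorem exists_reduction (u : P.M) (hu : u.1 ∉ P.B) : ∃ v w : P.M,
    P.weight v.1 = P.weight u.1 ∧ P.weight w.1 = P.weight u.1 - 1 ∧
    ∃ c : K, P.monomialClass u = (RatFunc.X : K) • P.monomialClass v + c • P.monomialClass w := by
  obtain ⟨hV, h0⟩ := P.mem_M_iff.1 u.2
  obtain ⟨k, hk⟩ : ∃ k, 1 ≤ P.coord u.1 k := by
    by_contra! h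
    exact hu (P.mem_B_iff.2 ⟨hV, fun j => ⟨h0 j, h j⟩⟩)
  have hw : u.1 - P.a k ∈ P.M := by
    refine P.mem_M_iff.2 ⟨P.VZ.sub_mem hV (P.a_mem_VZ k), fun j => ?_⟩
    rw [map_sub, Pi.sub_apply, coord_a, Pi.single_apply]
    split_ifs with h
    · subst h; linarith
    · simpa using h0 j
  let w : P.M := ⟨u.1 - P.a k, hw⟩
  have hu' : P.addM w (P.aM k) = u := Subtype.ext (by simp [addM, aM, w])
  have hlw : P.weight w.1 = P.weight u.1 - 1 := by
    have := P.weight_add w.1 (P.a k)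
    rw [show w.1 + P.a k = u.1 by simp [w], weight_a] at this
    linarith
  refine ⟨P.addM w P.a₀M, w, ?_, hlw, -((P.l k : K)⁻¹ * algebraMap ℝ K (P.coord w.1 k)), ?_⟩
  · change P.weight (w.1 + P.a₀) = _
    rw [weight_add, weight_a₀, hlw]; ring
  · have h := P.monomialClass_relation w k
    rw [hu'] at h
    have hl : (P.l k : K) ≠ 0 := by exact_mod_cast (P.l_pos k).ne'
    have h' := congrArg (fun x => (P.l k : K)⁻¹ • x) h
    simp only [smul_sub, smul_add, smul_smul, smul_zero, inv_mul_cancel₀ hl, one_smul,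
      inv_mul_cancel_left₀ hl] at h'
    rw [neg_smul, ← sub_eq_zero, ← h']
    abel

theorem monomialClass_mem_spanB_of_lower (d : ℝ)
    (hlow : ∀ u : P.M, P.weight u.1 = d - 1 → P.monomialClass u ∈ P.spanB) (u : P.M)
    (hu : P.weight u.1 = d) : P.monomialClass u ∈ P.spanB := by
  by_contra hnot
  -- The counterexamples of weight `d` form a finite set, which the reduction step maps to itself.
  let T := {v : P.M // P.weight v.1 = d ∧ P.monomialClass v ∉ P.spanB}
  have hfin : Finite T := ((P.finite_weight_eq d).subset fun _ h => h.1).to_subtype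
  have step : ∀ v : T, ∃ v' : T,
      P.monomialClass v.1 - (RatFunc.X : K) • P.monomialClass v'.1 ∈ P.spanB := by
    rintro ⟨v, hv, hvn⟩
    have hvB : v.1 ∉ P.B := fun h => hvn (Submodule.subset_span ⟨⟨v.1, h⟩, rfl⟩)
    obtain ⟨v', w, hv', hw, c, h⟩ := P.exists_reduction v hvB
    have hmem : P.monomialClass v - (RatFunc.X : K) • P.monomialClass v' ∈ P.spanB := by
      rw [h, add_sub_cancel_left]
      exact P.spanB.smul_mem _ (hlow w (by rw [hw, hv]))
    refine ⟨⟨v', hv'.trans hv, fun h' => hvn ?_⟩, hmem⟩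
    have := P.spanB.add_mem hmem (P.spanB.smul_mem (RatFunc.X : K) h')
    rwa [sub_add_cancel] at this
  choose σ hσ using step
  have iter : ∀ (r : ℕ) (v : T),
      P.monomialClass v.1 - (RatFunc.X : K) ^ r • P.monomialClass (σ^[r] v).1 ∈ P.spanB := by
    intro r
    induction r with
    | zero => intro v; simp
    | succ r ih =>
      intro v
      have h := P.spanB.add_mem (hσ v) (P.spanB.smul_mem (RatFunc.X : K) (ih (σ v)))
      rwa [smul_sub, smul_smul, ← pow_succ', sub_add_sub_cancel] at h
  obtain ⟨r, s, hrs, h⟩ : ∃ r s, r < s ∧ σ^[r] ⟨u, hu, hnot⟩ = σ^[s] ⟨u, hu, hnot⟩ := by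
    obtain ⟨r, s, hne, h⟩ := Finite.exists_ne_map_eq_of_infinite fun r => σ^[r] ⟨u, hu, hnot⟩
    rcases hne.lt_or_gt with h' | h'
    · exact ⟨r, s, h', h⟩
    · exact ⟨s, r, h', h.symm⟩
  obtain ⟨t, rfl⟩ := Nat.exists_eq_add_of_lt hrs
  -- The orbit returns to `v = σ^[r] u` after `t + 1 > 0` steps, so `(1 - λ^(t+1)) x^v` lies in the
  -- span.
  have h1 := iter (t + 1) (σ^[r] ⟨u, hu, hnot⟩)
  rw [← Function.iterate_add_apply, show t + 1 + r = r + t + 1 by ring, ← h] at h1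
  have h2 : (1 - (RatFunc.X : K) ^ (t + 1)) • P.monomialClass (σ^[r] ⟨u, hu, hnot⟩).1
      ∈ P.spanB := by
    rwa [sub_smul, one_smul]
  exact (σ^[r] ⟨u, hu, hnot⟩).2.2 ((P.spanB.smul_mem_iff
    (sub_ne_zero.2 (X_pow_ne_one t.succ_ne_zero).symm)).1 h2)

theorem spanB_eq_top : P.spanB = ⊤ := by
  have key : ∀ (N : ℕ) (u : P.M), P.weight u.1 < N → P.monomialClass u ∈ P.spanB := by
    intro N
    induction N with
    | zero => exact fun u hu => absurd (P.weight_nonneg u) (by simpa using hu)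
    | succ N ih =>
      refine fun u hu => P.monomialClass_mem_spanB_of_lower _ (fun v hv => ih v ?_) u rfl
      push_cast at hu
      linarith
  rw [eq_top_iff, ← P.span_monomialClass, Submodule.span_le]
  rintro _ ⟨u, rfl⟩
  obtain ⟨N, hN⟩ := exists_nat_gt (P.weight u.1)
  exact key N u hN

end DelsarteDeformation

/-! ### Independence: functionals with values in Laurent series -/

namespace DelsarteDeformation

section

open scoped RatFunc Matrix

variable {n m : ℕ} (P : DelsarteDeformation n m)

theorem algebraMap_laurentSeries_X :
    algebraMap K (LaurentSeries ℂ) RatFunc.X = HahnSeries.ofPowerSeries ℤ ℂ PowerSeries.X := by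
  rw [HahnSeries.ofPowerSeries_X]
  exact RatFunc.coe_X

theorem algebraMap_laurentSeries_real (c : ℝ) :
    algebraMap K (LaurentSeries ℂ) (algebraMap ℝ K c) =
      HahnSeries.ofPowerSeries ℤ ℂ (PowerSeries.C (c : ℂ)) := by
  have h := RatFunc.coe_coe (Polynomial.C (c : ℂ))
  rw [Polynomial.coe_C] at h
  exact h.symm

/-- The product `∏_{i < ⌊c⌋} -(fract c + i) / l`. -/
def gammaFactor (l : ℕ) (c : ℝ) : ℝ := ∏ i ∈ Finset.range ⌊c⌋₊, -((Int.fract c + i) / l)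

/-- The analogue of `Γ(c + 1) = c Γ(c)`: the one new factor, at `i = ⌊c⌋`, is `-c / l`. -/
theorem gammaFactor_add_one {l : ℕ} (hl : l ≠ 0) {c : ℝ} (hc : 0 ≤ c) :
    (l : ℝ) * gammaFactor l (c + 1) = -c * gammaFactor l c := by
  have h : Int.fract c + (⌊c⌋₊ : ℝ) = c := by
    rw [natCast_floor_eq_intCast_floor hc, Int.fract_add_floor]
  have hl' : (l : ℝ) ≠ 0 := by exact_mod_cast hl
  rw [gammaFactor, Nat.floor_add_one hc, Int.fract_add_one, Finset.prod_range_succ, h,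
    ← gammaFactor]
  field_simp

/-- The coefficient of `x^b` in the reduction of `x^u` modulo the relations at `λ = 0`. -/
def coeffAtZero (b u : Fin n → ℤ) : ℝ :=
  open Classical in
  if ∀ j, Int.fract (P.coord u j) = Int.fract (P.coord b j) then
    ∏ j, gammaFactor (P.l j) (P.coord u j) else 0

/-- Adding `a_k` preserves all fractional parts and changes only the `k`-th factor. -/
theorem coeffAtZero_add_a (b : Fin n → ℤ) {u : Fin n → ℤ} (hu : u ∈ P.M) (k : Fin m) :
    P.coord u k * P.coeffAtZero b u + P.l k * P.coeffAtZero b (u + P.a k) = 0 := by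
  have hk : P.coord (u + P.a k) k = P.coord u k + 1 := by simp [coord_a]
  have hj : ∀ j, j ≠ k → P.coord (u + P.a k) j = P.coord u j := fun j h => by
    simp [coord_a, h]
  have hf : ∀ j, Int.fract (P.coord (u + P.a k) j) = Int.fract (P.coord u j) := fun j => by
    rcases eq_or_ne j k with rfl | h
    · rw [hk, Int.fract_add_one]
    · rw [hj j h]
  simp only [coeffAtZero, hf]
  split_ifs
  · rw [← Finset.mul_prod_erase _ _ (Finset.mem_univ k),
      ← Finset.mul_prod_erase _ (fun j => gammaFactor (P.l j) (P.coord (u + P.a k) j))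
        (Finset.mem_univ k), hk, ← mul_assoc (P.l k : ℝ),
      gammaFactor_add_one (P.l_pos k).ne' ((P.mem_M_iff.1 hu).2 k),
      Finset.prod_congr rfl fun j h => by rw [← hj j (Finset.ne_of_mem_erase h)]]
    ring
  · simp

theorem coeffAtZero_of_mem_B {b b' : Fin n → ℤ} (hb : b ∈ P.B) (hb' : b' ∈ P.B) :
    P.coeffAtZero b b' = if b = b' then 1 else 0 := by
  by_cases h : b = b'
  · subst h
    rw [coeffAtZero, if_pos fun j => rfl, if_pos rfl]
    refine Finset.prod_eq_one fun j _ => ?_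
    rw [gammaFactor, Nat.floor_eq_zero.2 ((P.mem_B_iff.1 hb).2 j).2, Finset.prod_range_zero]
  · rw [coeffAtZero, if_neg fun h' => h (P.eq_of_fract_eq hb' hb h').symm, if_neg h]

/-- The power series `∑_r (-ℓ₀λ)^r / r! · h_b(u + r a₀)`, where `h_b` is the coefficient of `x^b`
in the reduction at `λ = 0`. -/
def coeffSeries (b u : Fin n → ℤ) : PowerSeries ℂ :=
  PowerSeries.mk fun r => (((-P.l₀ : ℝ) ^ r / r.factorial * P.coeffAtZero b (u + r • P.a₀) : ℝ) : ℂ)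

theorem coeffSeries_relation (b : Fin n → ℤ) {u : Fin n → ℤ} (hu : u ∈ P.M) (k : Fin m) :
    PowerSeries.C (P.coord u k : ℂ) * P.coeffSeries b u +
      PowerSeries.C (P.l k : ℂ) * P.coeffSeries b (u + P.a k) -
      PowerSeries.C (P.l k : ℂ) * (PowerSeries.X * P.coeffSeries b (u + P.a₀)) = 0 := by
  have hmem : ∀ r : ℕ, u + r • P.a₀ ∈ P.M := by
    intro r
    induction r with
    | zero => simpa using hu
    | succ r ih => rw [succ_nsmul, ← add_assoc]; exact P.add_mem_M ih P.a₀_mem_M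
  ext r
  rw [map_zero, map_sub, map_add, PowerSeries.coeff_C_mul, PowerSeries.coeff_C_mul,
    PowerSeries.coeff_C_mul]
  cases r with
  | zero =>
    rw [PowerSeries.coeff_zero_X_mul]
    have h := P.coeffAtZero_add_a b hu k
    simp only [coeffSeries, PowerSeries.coeff_mk, pow_zero, Nat.factorial_zero, zero_smul,
      Nat.cast_one, div_one, one_mul, add_zero, mul_zero, sub_zero]
    exact_mod_cast h
  | succ r =>
    rw [PowerSeries.coeff_succ_X_mul]
    have h := P.coeffAtZero_add_a b (hmem (r + 1)) k
    have hl := P.l₀_ne_zero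
    -- The surplus `(r + 1) ℓ_k / ℓ₀` in this coordinate, times `(-ℓ₀)^(r+1) / (r+1)!`, is `-ℓ_k
    -- (-ℓ₀)^r / r!`, which cancels the `λ` term.
    have hc : P.coord (u + (r + 1) • P.a₀) k = P.coord u k + (r + 1) * (P.l k / P.l₀) := by
      rw [map_add, map_nsmul, Pi.add_apply, Pi.smul_apply, coord_a₀, nsmul_eq_mul]
      push_cast
      ring
    have e1 : u + P.a k + (r + 1) • P.a₀ = u + (r + 1) • P.a₀ + P.a k := by abel
    have e2 : u + P.a₀ + r • P.a₀ = u + (r + 1) • P.a₀ := by rw [succ_nsmul]; abel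
    simp only [coeffSeries, PowerSeries.coeff_mk, e1, e2]
    rw [hc] at h
    norm_cast
    have hr : (r.factorial : ℝ) ≠ 0 := by exact_mod_cast r.factorial_ne_zero
    have hr' : ((r : ℝ) + 1) ≠ 0 := by positivity
    rw [Nat.factorial_succ, pow_succ]
    generalize P.coeffAtZero b (u + (r + 1) • P.a₀) = x at h ⊢
    generalize P.coeffAtZero b (u + (r + 1) • P.a₀ + P.a k) = y at h ⊢
    push_cast
    have hy : (P.l k : ℝ) * y = -((P.coord u k + (r + 1) * (P.l k / P.l₀)) * x) := by linarith
    rw [mul_left_comm (P.l k : ℝ) _ y, hy]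
    field_simp
    ring

/-- The `ℂ(λ)`-linear functional on the Laurent polynomial ring with `x^u ↦ coeffSeries b u`. -/
def functional (b : Fin n → ℤ) : Laurent K n →ₗ[K] LaurentSeries ℂ :=
  Finsupp.linearCombination K
      (fun u : Fin n → ℤ => HahnSeries.ofPowerSeries ℤ ℂ (P.coeffSeries b u)) ∘ₗ
    (AddMonoidAlgebra.coeffLinearEquiv K).toLinearMap

theorem functional_xpow (b u : Fin n → ℤ) :
    P.functional b (xpow K u) = HahnSeries.ofPowerSeries ℤ ℂ (P.coeffSeries b u) := by
  simp [functional]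

theorem functional_rel (b : Fin n → ℤ) (u : P.M) (k : Fin m) :
    P.functional b (P.rel u k : Laurent K n) = 0 := by
  have h := congrArg (HahnSeries.ofPowerSeries ℤ ℂ) (P.coeffSeries_relation b u.2 k)
  have hl : algebraMap K (LaurentSeries ℂ) (P.l k : K) =
      HahnSeries.ofPowerSeries ℤ ℂ (PowerSeries.C (P.l k : ℂ)) := by simp
  simp only [rel, mono, addM, aM, a₀M, Subalgebra.coe_smul, Subalgebra.coe_sub,
    Subalgebra.coe_add, map_sub, map_add, map_smul, functional_xpow]
  simp only [Algebra.smul_def, map_mul, hl, algebraMap_laurentSeries_X,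
    algebraMap_laurentSeries_real]
  simpa only [map_sub, map_add, map_mul, map_zero, mul_assoc] using h

theorem functional_eq_zero (b : Fin n → ℤ) {g : P.S'} (hg : g ∈ P.relSubmodule) :
    P.functional b (g : Laurent K n) = 0 :=
  P.relSubmodule_le (N := LinearMap.ker (P.functional b ∘ₗ P.S'.val.toLinearMap))
    (P.functional_rel b) hg

theorem linearIndependent_B : LinearIndependent K
    fun b : P.B => P.monomialClass ⟨b.1, P.B_subset_M b.2⟩ := by
  have := P.finite_B.fintype
  classical
  let A : Matrix P.B P.B (PowerSeries ℂ) := .of fun b b' => P.coeffSeries b.1 b'.1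
  have hA : A.det ≠ 0 := by
    intro h
    -- Setting `λ = 0` turns the matrix into the identity by `coeffAtZero_of_mem_B`.
    have h1 := congrArg (PowerSeries.constantCoeff (R := ℂ)) h
    have h2 : (PowerSeries.constantCoeff (R := ℂ)).mapMatrix A = 1 := by
      ext b b'
      rw [RingHom.mapMatrix_apply, Matrix.map_apply, Matrix.one_apply,
        show A b b' = P.coeffSeries b.1 b'.1 from rfl,
        ← PowerSeries.coeff_zero_eq_constantCoeff_apply, coeffSeries, PowerSeries.coeff_mk]
      simp [P.coeffAtZero_of_mem_B b.2 b'.2, Subtype.ext_iff, apply_ite]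
    rw [RingHom.map_det, h2, Matrix.det_one, map_zero] at h1
    exact one_ne_zero h1
  have hA' : ((HahnSeries.ofPowerSeries ℤ ℂ).mapMatrix A).det ≠ 0 := by
    rw [← RingHom.map_det]
    exact (map_ne_zero_iff _ HahnSeries.ofPowerSeries_injective).2 hA
  rw [Fintype.linearIndependent_iff]
  intro g hg
  have hmem : ∑ b : P.B, g b • P.mono ⟨b.1, P.B_subset_M b.2⟩ ∈ P.relSubmodule := by
    rw [← Submodule.Quotient.mk_eq_zero, ← Submodule.mkQ_apply, map_sum]
    simp only [map_smul]
    exact hg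
  -- Applying every functional to a vanishing combination puts its coefficients in the kernel of the
  -- matrix.
  have hv : (HahnSeries.ofPowerSeries ℤ ℂ).mapMatrix A *ᵥ
      (fun b => algebraMap K (LaurentSeries ℂ) (g b)) = 0 := by
    funext b
    have h := P.functional_eq_zero b.1 hmem
    simp only [AddSubmonoidClass.coe_finsetSum, Subalgebra.coe_smul, mono, map_sum, map_smul,
      functional_xpow] at h
    simp only [Algebra.smul_def] at h
    simpa only [Matrix.mulVec, dotProduct, RingHom.mapMatrix_apply, Matrix.map_apply,
      Pi.zero_apply, mul_comm, A, Matrix.of_apply] using h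
  have h0 := Matrix.eq_zero_of_mulVec_eq_zero hA' hv
  exact fun b => (map_eq_zero _).1 (congrFun h0 b)

end

end DelsarteDeformation

theorem proposition5p34 {n m : ℕ} (P : DelsarteDeformation n m) :
    (∃ e : Module.Basis P.B (RatFunc ℂ) P.W',
      ∀ b : P.B, e b = P.monomialClass ⟨b.1, P.B_subset_M b.2⟩) ∧
    P.B.Finite ∧
    Module.finrank (RatFunc ℂ) P.W' = P.B.ncard ∧
    P.B.ncard = P.ZA.relIndex P.VZ := by
  let e := Module.Basis.mk P.linearIndependent_B P.spanB_eq_top.ge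
  refine ⟨⟨e, fun b => Module.Basis.mk_apply _ _ b⟩, P.finite_B, ?_, P.ncard_B⟩
  rw [Module.finrank_eq_nat_card_basis e]
  rfl

end
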